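/- Let $z_1,z_2\in\mathbb{C}$, $r>0$, $E_{\mathrm{tol}}>0$, and let $L(z_1,z_2,r)=\{z\in\mathbb{C} : |z-z_1|+|z-z_2|\le\cosh(r)\,|z_2-z_1|\}$ be the closed elliptical region with foci $z_1,z_2$. Suppose that $g$ is holomorphic on (an open neighbourhood of) $L(z_1,z_2,r)$ and that $|g(z)|\le M$ for all $z\in L(z_1,z_2,r)$. Let $N\ge 0$ be an integer with $$N\ \ge\ \frac{1}{2r}\left[\log\left(\pi+\frac{64}{15(e^{2r}-1)}\right)+\log M+\log\left(\tfrac12|z_2-z_1|\right)-\log E_{\mathrm{tol}}\right]$$ (in the degenerate cases $M=0$ or $z_1=z_2$, $\log 0$ is read as $0$). Put $$h(z)=\frac{z_2-z_1}{2}\,g\left(\tfrac12\big((1-z)z_1+(1+z)z_2\big)\right)$$ and let $$I_N(h)=\sum_{i=1}^N w_i\,h(x_i),\qquad w_i=\frac{2}{(1-x_i^2)\,P_N'(x_i)^2},$$ be the $N$-point Gauss–Legendre quadrature of $h$ on $[-1,1]$, where $x_1,\dots,x_N$ are the roots of the Legendre polynomial $P_N(x)=\frac{1}{2^N N!}\frac{d^N}{dx^N}(x^2-1)^N$.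 Then $$\left|\int_{z_1}^{z_2} g(z)\,dz-I_N(h)\right|\le E_{\mathrm{tol}},$$ where the integral is taken along the straight line segment from $z_1$ to $z_2$. -/

import Mathlib

namespace GaussLegendre

open Polynomial

/-- The Legendre polynomial `P_N`, by Rodrigues' formula
`P_N(x) = (1 / (2 ^ N * N!)) * (d/dx) ^ N (x ^ 2 - 1) ^ N`. -/
noncomputable def legendre (N : ℕ) : ℝ[X] :=
  C (1 / (2 ^ N * (N.factorial : ℝ))) * derivative^[N] ((X ^ 2 - 1) ^ N)

/-- The nodes of the `N`-th order Gauss-Legendre quadrature: the roots of `P_N`. -/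
noncomputable def nodes (N : ℕ) : Finset ℝ :=
  (legendre N).roots.toFinset

/-- The weight `2 / ((1 - x ^ 2) * P_N'(x) ^ 2)` attached to a node `x`. -/
noncomputable def weight (N : ℕ) (x : ℝ) : ℝ :=
  2 / ((1 - x ^ 2) * ((derivative (legendre N)).eval x) ^ 2)

/-- The `N`-th order Gauss-Legendre approximation `I_N(h)` of the integral of `h` over `[-1, 1]`. -/
noncomputable def quadrature (N : ℕ) (h : ℂ → ℂ) : ℂ :=
  ∑ x ∈ nodes N, (weight N x : ℂ) * h (x : ℂ)

/-- The closed elliptical region `L(z₁, z₂, r)` with foci `z₁` and `z₂`. -/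
def ellipse (z₁ z₂ : ℂ) (r : ℝ) : Set ℂ :=
  {z | ‖z - z₁‖ + ‖z - z₂‖ ≤ Real.cosh r * ‖z₂ - z₁‖}

/-- The affinely rescaled integrand `h` on `[-1, 1]`. -/
noncomputable def rescale (z₁ z₂ : ℂ) (g : ℂ → ℂ) (z : ℂ) : ℂ :=
  (z₂ - z₁) / 2 * g ((1 / 2) * ((1 - z) * z₁ + (1 + z) * z₂))

/-- The integral `∫_{z₁}^{z₂} g(z) dz` along the straight line segment from `z₁` to `z₂`,
as the curve integral of the 1-form `g(z) dz`. -/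
noncomputable def segmentIntegral (z₁ z₂ : ℂ) (g : ℂ → ℂ) : ℂ :=
  ∫ᶜ z in Path.segment z₁ z₂, g z • ContinuousLinearMap.id ℂ ℂ

end GaussLegendre

/-! After an affine change of variable the claim concerns `h` on `[-1, 1]`, analytic and bounded by
`K` on the Bernstein ellipse of parameter `ρ = exp r`. The Joukowsky map `w ↦ (w + w⁻¹) / 2` pulls
`h` back to an annulus, where Cauchy estimates for Laurent coefficients give a Chebyshev expansion
with `‖a n‖ ≤ 2 * K * ρ⁻¹ ^ n` (`exists_hasSum_chebyshev`).

The quadrature error is linear, so it suffices to know it on each `T n`. It vanishes for `n < 2 * N`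
by Gauss exactness (`sum_weight_mul_eval`) and for odd `n` by symmetry. At `n = 2 * N` it is exactly
the Wallis product, at most `π / 2` (`quadratureError_T_two_mul`). For `n ≥ 4` it is at most `32 /
15` (`abs_quadratureError_T_le`). Summing over even `n ≥ 2 * N` gives `K * ρ ^ (-2 * N) * (π + 64 /
(15 * (ρ ^ 2 - 1)))`, and the hypothesis on `N` is this bound being at most `Etol`, after
logarithms. -/

namespace GaussLegendre

open Polynomial

/-! ### Legendre polynomials: endpoint values, degree, orthogonality. -/

/-- Integration of a real polynomial over `[-1, 1]`, as a linear functional. -/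
noncomputable def polyIntegral : ℝ[X] →ₗ[ℝ] ℝ where
  toFun p := ∫ x in (-1 : ℝ)..1, p.eval x
  map_add' p q := by
    simp only [eval_add]
    exact intervalIntegral.integral_add (p.continuous.intervalIntegrable _ _)
      (q.continuous.intervalIntegrable _ _)
  map_smul' c p := by
    simp only [eval_smul, RingHom.id_apply]
    exact intervalIntegral.integral_smul _ _

lemma polyIntegral_apply (p : ℝ[X]) : polyIntegral p = ∫ x in (-1 : ℝ)..1, p.eval x := rfl

lemma polyIntegral_derivative (p : ℝ[X]) :
    polyIntegral (derivative p) = p.eval 1 - p.eval (-1) :=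
  intervalIntegral.integral_eq_sub_of_hasDerivAt (fun x _ => p.hasDerivAt x)
    ((derivative p).continuous.intervalIntegrable _ _)

lemma polyIntegral_C_mul (c : ℝ) (p : ℝ[X]) : polyIntegral (C c * p) = c * polyIntegral p := by
  rw [← smul_eq_C_mul, map_smul, smul_eq_mul]

/-- The derivative is `n!` times a Taylor coefficient at `a`, and recentring at `a` turns `(X - C a)
^ n` into `X ^ n`. -/
lemma eval_iterate_derivative_pow_mul (a : ℝ) (n : ℕ) (q : ℝ[X]) :
    (derivative^[n] ((X - C a) ^ n * q)).eval a = n.factorial * q.eval a := by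
  rw [← factorial_smul_hasseDeriv, LinearMap.smul_apply, eval_smul, ← taylor_coeff, taylor_mul,
    taylor_pow]
  simp [coeff_X_pow_mul']

lemma eval_iterate_derivative_pow_mul_of_lt (a : ℝ) {j n : ℕ} (hj : j < n) (q : ℝ[X]) :
    (derivative^[j] ((X - C a) ^ n * q)).eval a = 0 := by
  rw [← factorial_smul_hasseDeriv, LinearMap.smul_apply, eval_smul, ← taylor_coeff, taylor_mul,
    taylor_pow]
  simp [coeff_X_pow_mul', hj]

lemma sq_sub_one_pow_eq (N : ℕ) : ((X ^ 2 - 1) ^ N : ℝ[X]) = (X - C 1) ^ N * (X + C 1) ^ N := by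
  rw [← mul_pow]; congr 1; rw [C_1]; ring

lemma sq_sub_one_pow_eq' (N : ℕ) :
    ((X ^ 2 - 1) ^ N : ℝ[X]) = (X - C (-1)) ^ N * (X - C 1) ^ N := by
  rw [← mul_pow]; congr 1; rw [C_neg, C_1]; ring

lemma eval_one_iterate_derivative {j N : ℕ} (hj : j < N) :
    (derivative^[j] ((X ^ 2 - 1) ^ N : ℝ[X])).eval 1 = 0 := by
  rw [sq_sub_one_pow_eq]; exact eval_iterate_derivative_pow_mul_of_lt 1 hj _

lemma eval_neg_one_iterate_derivative {j N : ℕ} (hj : j < N) :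
    (derivative^[j] ((X ^ 2 - 1) ^ N : ℝ[X])).eval (-1) = 0 := by
  rw [sq_sub_one_pow_eq']; exact eval_iterate_derivative_pow_mul_of_lt (-1) hj _

lemma legendre_eval_one (N : ℕ) : (legendre N).eval 1 = 1 := by
  rw [legendre, sq_sub_one_pow_eq, eval_mul, eval_iterate_derivative_pow_mul]
  have : (N.factorial : ℝ) ≠ 0 := by positivity
  simp only [eval_C, eval_pow, eval_add, eval_X]
  norm_num
  field_simp

lemma legendre_eval_neg_one (N : ℕ) : (legendre N).eval (-1) = (-1) ^ N := by
  rw [legendre, sq_sub_one_pow_eq', eval_mul, eval_iterate_derivative_pow_mul]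
  have : (N.factorial : ℝ) ≠ 0 := by positivity
  simp only [eval_C, eval_pow, eval_sub, eval_X]
  rw [show (-1 - 1 : ℝ) = (-1) * 2 by norm_num, mul_pow]
  field_simp

lemma natDegree_sq_sub_one_pow (N : ℕ) : ((X ^ 2 - 1) ^ N : ℝ[X]).natDegree = 2 * N := by
  rw [natDegree_pow, show (X ^ 2 - 1 : ℝ[X]) = X ^ 2 - C 1 by simp, natDegree_X_pow_sub_C, mul_comm]

lemma natDegree_legendre_le (N : ℕ) : (legendre N).natDegree ≤ N := by
  refine (natDegree_C_mul_le _ _).trans ((natDegree_iterate_derivative _ _).trans ?_)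
  rw [natDegree_sq_sub_one_pow]; omega

lemma coeff_legendre (N : ℕ) :
    (legendre N).coeff N = (2 * N).factorial / (2 ^ N * (N.factorial : ℝ) ^ 2) := by
  have hm : ((X ^ 2 - 1) ^ N : ℝ[X]).Monic := by
    have : (X ^ 2 - C 1 : ℝ[X]).Monic := monic_X_pow_sub_C _ two_ne_zero
    simpa using this.pow N
  have h1 : ((X ^ 2 - 1) ^ N : ℝ[X]).coeff (N + N) = 1 := by
    have := hm.coeff_natDegree
    rwa [natDegree_sq_sub_one_pow, two_mul] at this
  rw [legendre, coeff_C_mul, coeff_iterate_derivative, h1, ← two_mul, nsmul_eq_mul, mul_one,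
    Nat.descFactorial_eq_div (by omega), Nat.cast_div (Nat.factorial_dvd_factorial (by omega))
      (by positivity), show 2 * N - N = N by omega]
  field_simp

lemma coeff_legendre_pos (N : ℕ) : 0 < (legendre N).coeff N := by
  rw [coeff_legendre]; positivity

lemma natDegree_legendre (N : ℕ) : (legendre N).natDegree = N :=
  natDegree_eq_of_le_of_coeff_ne_zero (natDegree_legendre_le N) (coeff_legendre_pos N).ne'

lemma legendre_ne_zero (N : ℕ) : legendre N ≠ 0 := fun h => by
  simpa [h] using coeff_legendre_pos N

/-- Repeated integration by parts against a derivative of `(x ^ 2 - 1) ^ N`. -/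
lemma polyIntegral_iterate_derivative_mul (N : ℕ) (q : ℝ[X]) {j : ℕ} (hj : j ≤ N) :
    polyIntegral (derivative^[j] ((X ^ 2 - 1) ^ N) * q)
      = (-1) ^ j * polyIntegral ((X ^ 2 - 1) ^ N * derivative^[j] q) := by
  induction j generalizing q with
  | zero => simp
  | succ j ih =>
    have h := polyIntegral_derivative (derivative^[j] ((X ^ 2 - 1) ^ N) * q)
    rw [derivative_mul, map_add, eval_mul, eval_mul, eval_one_iterate_derivative (by omega),
      eval_neg_one_iterate_derivative (by omega), ih _ (by omega)] at h
    rw [Function.iterate_succ_apply', Function.iterate_succ_apply, pow_succ (-1 : ℝ)]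
    linarith

lemma polyIntegral_legendre_mul (N : ℕ) (q : ℝ[X]) :
    polyIntegral (legendre N * q) = 1 / (2 ^ N * N.factorial) *
      ((-1) ^ N * polyIntegral ((X ^ 2 - 1) ^ N * derivative^[N] q)) := by
  rw [legendre, mul_assoc, polyIntegral_C_mul, polyIntegral_iterate_derivative_mul N q le_rfl]

lemma polyIntegral_legendre_mul_eq_zero {N : ℕ} {q : ℝ[X]} (hq : q.degree < N) :
    polyIntegral (legendre N * q) = 0 := by
  rw [polyIntegral_legendre_mul, iterate_derivative_eq_zero_of_degree_lt hq]
  simp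

/-! ### Location and simplicity of the nodes. -/

/-- Rolle, inductively: for `j < N` the endpoints `±1` are also zeros of the `j`-th derivative, so
`j` interior zeros yield `j + 1` for the next one. -/
lemma exists_roots_iterate_derivative {j N : ℕ} (hj : j ≤ N) :
    ∃ t : Finset ℝ, t.card = j ∧ ∀ x ∈ t, (-1 < x ∧ x < 1) ∧
      (derivative^[j] ((X ^ 2 - 1) ^ N : ℝ[X])).eval x = 0 := by
  induction j with
  | zero => exact ⟨∅, by simp⟩
  | succ j ih =>
    obtain ⟨t, htc, ht⟩ := ih (by omega)
    set p : ℝ[X] := derivative^[j] ((X ^ 2 - 1) ^ N) with hp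
    -- Otherwise further differentiation would make `legendre N` vanish.
    have hp0 : derivative p ≠ 0 := by
      rw [hp, ← Function.iterate_succ_apply' (f := derivative)]
      intro h
      have h2 := congrArg (derivative^[N - (j + 1)]) h
      rw [← Function.iterate_add_apply, show N - (j + 1) + (j + 1) = N by omega,
        iterate_derivative_zero] at h2
      apply legendre_ne_zero N
      rw [legendre, h2, mul_zero]
    set s : Finset ℝ := (derivative p).roots.toFinset.filter (fun x => -1 < x ∧ x < 1) with hs
    have h1 : (1 : ℝ) ∉ t := fun h => lt_irrefl _ (ht _ h).1.2
    have h2 : (-1 : ℝ) ∉ insert (1 : ℝ) t := by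
      simp only [Finset.mem_insert, not_or]
      exact ⟨by norm_num, fun h => lt_irrefl _ (ht _ h).1.1⟩
    have hzero : ∀ x ∈ insert (-1 : ℝ) (insert 1 t), (-1 ≤ x ∧ x ≤ 1) ∧ p.eval x = 0 := by
      intro x hx
      simp only [Finset.mem_insert] at hx
      rcases hx with rfl | rfl | hx
      · exact ⟨by norm_num, eval_neg_one_iterate_derivative (by omega)⟩
      · exact ⟨by norm_num, eval_one_iterate_derivative (by omega)⟩
      · exact ⟨⟨(ht x hx).1.1.le, (ht x hx).1.2.le⟩, (ht x hx).2⟩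
    have hcard : (insert (-1 : ℝ) (insert 1 t)).card ≤ s.card + 1 := by
      refine Finset.card_le_of_interleaved fun x hx y hy hxy _ => ?_
      obtain ⟨z, hz, hz'⟩ := exists_deriv_eq_zero hxy p.continuous.continuousOn
        ((hzero x hx).2.trans (hzero y hy).2.symm)
      refine ⟨z, ?_, hz.1, hz.2⟩
      simp only [hs, Finset.mem_filter, Multiset.mem_toFinset, mem_roots hp0, IsRoot.def]
      refine ⟨by rw [← Polynomial.deriv]; exact hz', ?_, ?_⟩
      · exact (hzero x hx).1.1.trans_lt hz.1
      · exact hz.2.trans_le (hzero y hy).1.2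
    rw [Finset.card_insert_of_notMem h2, Finset.card_insert_of_notMem h1, htc] at hcard
    obtain ⟨u, hus, huc⟩ := Finset.exists_subset_card_eq (show j + 1 ≤ s.card by omega)
    refine ⟨u, huc, fun x hx => ?_⟩
    have := hus hx
    simp only [hs, Finset.mem_filter, Multiset.mem_toFinset, mem_roots hp0, IsRoot.def] at this
    rw [Function.iterate_succ_apply']
    exact ⟨this.2, this.1⟩

lemma mem_nodes {N : ℕ} {x : ℝ} : x ∈ nodes N ↔ (legendre N).eval x = 0 := by
  rw [nodes, Multiset.mem_toFinset, mem_roots (legendre_ne_zero N), IsRoot.def]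

lemma card_nodes_le (N : ℕ) : (nodes N).card ≤ N :=
  (Multiset.toFinset_card_le _).trans ((card_roots' _).trans (natDegree_legendre_le N))

lemma nodes_spec (N : ℕ) : (nodes N).card = N ∧ ∀ x ∈ nodes N, -1 < x ∧ x < 1 := by
  obtain ⟨t, htc, ht⟩ := exists_roots_iterate_derivative (le_refl N)
  have hsub : t ⊆ nodes N := fun x hx => by
    rw [mem_nodes, legendre, eval_mul, (ht x hx).2, mul_zero]
  have heq : t = nodes N := Finset.eq_of_subset_of_card_le hsub (by rw [htc]; exact card_nodes_le N)
  rw [← heq]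
  exact ⟨htc, fun x hx => (ht x hx).1⟩

lemma card_nodes (N : ℕ) : (nodes N).card = N := (nodes_spec N).1

lemma mem_Ioo_of_mem_nodes {N : ℕ} {x : ℝ} (hx : x ∈ nodes N) : -1 < x ∧ x < 1 :=
  (nodes_spec N).2 x hx

lemma eval_derivative_legendre_ne_zero {N : ℕ} {x : ℝ} (hx : x ∈ nodes N) :
    (derivative (legendre N)).eval x ≠ 0 := by
  have hroots : (legendre N).roots.card ≤ (legendre N).roots.toFinset.card := by
    have h : (legendre N).roots.toFinset.card = N := card_nodes N
    rw [h]; exact (card_roots' _).trans (natDegree_legendre_le N)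
  have hnd : (legendre N).roots.Nodup :=
    Multiset.toFinset_card_eq_card_iff_nodup.mp (le_antisymm (Multiset.toFinset_card_le _) hroots)
  intro h0
  have h1 : 1 < (legendre N).rootMultiplicity x :=
    (one_lt_rootMultiplicity_iff_isRoot (legendre_ne_zero N)).mpr ⟨mem_nodes.mp hx, h0⟩
  rw [← count_roots] at h1
  exact absurd (Multiset.nodup_iff_count_le_one.mp hnd x) (by omega)

lemma weight_pos {N : ℕ} {x : ℝ} (hx : x ∈ nodes N) : 0 < weight N x := by
  have h := mem_Ioo_of_mem_nodes hx
  have h2 := eval_derivative_legendre_ne_zero hx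
  have : 0 < 1 - x ^ 2 := by nlinarith
  unfold weight; positivity

/-! ### Gauss exactness and the explicit weights. -/

/-- Gauss quadrature with the Lagrange weights integrates polynomials of degree `< 2 * N`. -/
lemma polyIntegral_eq_sum_basis {N : ℕ} {f : ℝ[X]} (hf : f.degree < (2 * N : ℕ)) :
    polyIntegral f = ∑ x ∈ nodes N, polyIntegral (Lagrange.basis (nodes N) id x) * f.eval x := by
  have hL := legendre_ne_zero N
  have hdL : (legendre N).degree = N := by
    rw [degree_eq_natDegree hL, natDegree_legendre]
  -- The quotient has degree below `N`, so its product with `legendre N` integrates to zero; that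
  -- product also vanishes at the nodes. Only the remainder matters, and Lagrange interpolation
  -- reproduces it.
  have hdecomp := EuclideanDomain.div_add_mod f (legendre N)
  have hr : (f % legendre N).degree < N := hdL ▸ EuclideanDomain.mod_lt f hL
  have hq : (f / legendre N).degree < N := by
    by_cases h0 : f / legendre N = 0
    · rw [h0, degree_zero]; exact WithBot.bot_lt_coe _
    by_contra hge
    push Not at hge
    have h1 : ((2 * N : ℕ) : WithBot ℕ) ≤ (legendre N * (f / legendre N)).degree := by
      rw [degree_mul, hdL, two_mul, Nat.cast_add]; gcongr
    have hN : (N : WithBot ℕ) ≤ (2 * N : ℕ) := by norm_cast; omega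
    have h2 : f.degree = (legendre N * (f / legendre N)).degree := by
      conv_lhs => rw [← hdecomp]
      exact degree_add_eq_left_of_degree_lt (hr.trans_le (hN.trans h1))
    exact absurd hf (not_lt.mpr (h2 ▸ h1))
  have hfr : ∀ x ∈ nodes N, f.eval x = (f % legendre N).eval x := fun x hx => by
    conv_lhs => rw [← hdecomp]
    rw [eval_add, eval_mul, mem_nodes.mp hx, zero_mul, zero_add]
  have hint : polyIntegral f = polyIntegral (f % legendre N) := by
    conv_lhs => rw [← hdecomp]
    rw [map_add, polyIntegral_legendre_mul_eq_zero hq, zero_add]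
  rw [hint, Lagrange.eq_interpolate (s := nodes N) (v := id) (f := f % legendre N)
    (Set.injOn_id _) (by rwa [card_nodes]), Lagrange.interpolate_apply, map_sum]
  refine Finset.sum_congr rfl fun x hx => ?_
  rw [polyIntegral_C_mul, hfr x hx, mul_comm, id]

/-- Write `legendre N = (X - C x) * u` and apply exactness to the derivative of `(X - C x) * u ^ 2`.
It vanishes at the other nodes and equals `P_N'(x) ^ 2` at `x`, while its integral is the boundary
term `1 / (1 - x) + 1 / (1 + x)`, because `P_N(±1) ^ 2 = 1`. -/
lemma polyIntegral_basis {N : ℕ} {x : ℝ} (hx : x ∈ nodes N) :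
    polyIntegral (Lagrange.basis (nodes N) id x) = weight N x := by
  obtain ⟨u, hu⟩ := dvd_iff_isRoot.mpr (mem_nodes.mp hx)
  have hI := mem_Ioo_of_mem_nodes hx
  have hN : 0 < N := by rw [← card_nodes N]; exact Finset.card_pos.mpr ⟨x, hx⟩
  have hu0 : u ≠ 0 := fun h => legendre_ne_zero N (by rw [hu, h, mul_zero])
  have hdu : u.natDegree + 1 = N := by
    have h := natDegree_legendre N
    rw [hu, natDegree_mul (X_sub_C_ne_zero x) hu0, natDegree_X_sub_C] at h
    omega
  have hux : u.eval x = (derivative (legendre N)).eval x := by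
    rw [hu, derivative_mul]; simp
  have huy : ∀ y ∈ nodes N, y ≠ x → u.eval y = 0 := fun y hy hyx => by
    have := mem_nodes.mp hy
    rw [hu, eval_mul, eval_sub, eval_X, eval_C] at this
    exact (mul_eq_zero.mp this).resolve_left (sub_ne_zero.mpr hyx)
  set v : ℝ[X] := (X - C x) * u ^ 2 with hv
  have hv' : derivative v = u ^ 2 + (X - C x) * (2 * u * derivative u) := by
    rw [hv, derivative_mul, derivative_pow]; simp [map_ofNat]
  have hdeg : (derivative v).degree < (2 * N : ℕ) := by
    refine (degree_derivative_le).trans_lt (degree_le_natDegree.trans_lt ?_)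
    have : v.natDegree < 2 * N := by
      rw [hv, natDegree_mul (X_sub_C_ne_zero x) (pow_ne_zero 2 hu0), natDegree_X_sub_C,
        natDegree_pow]
      omega
    exact_mod_cast this
  have h1 := polyIntegral_eq_sum_basis hdeg
  rw [Finset.sum_eq_single x, polyIntegral_derivative] at h1
  · have e1 : (1 - x) * u.eval 1 = 1 := by
      have := legendre_eval_one N
      rw [hu] at this; simpa using this
    have e2 : (-1 - x) * u.eval (-1) = (-1) ^ N := by
      have := legendre_eval_neg_one N
      rw [hu] at this; simpa using this
    have e2' : ((1 + x) * u.eval (-1)) ^ 2 = 1 := by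
      have : ((1 + x) * u.eval (-1)) ^ 2 = ((-1 - x) * u.eval (-1)) ^ 2 := by ring
      rw [this, e2, ← pow_mul, mul_comm, pow_mul]; simp
    have e1' : ((1 - x) * u.eval 1) ^ 2 = 1 := by rw [e1]; norm_num
    have hd := eval_derivative_legendre_ne_zero hx
    rw [hv'] at h1
    simp only [hv, eval_mul, eval_pow, eval_sub, eval_X, eval_C, eval_add, sub_self, zero_mul,
      add_zero, hux] at h1
    have p1 : 0 < 1 - x := by linarith
    have p2 : 0 < 1 + x := by linarith
    have a1 : (1 - x) * u.eval 1 ^ 2 = 1 / (1 - x) := by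
      rw [eq_div_iff p1.ne']; linear_combination e1'
    have a2 : (-1 - x) * u.eval (-1) ^ 2 = - (1 / (1 + x)) := by
      rw [← neg_eq_iff_eq_neg, eq_div_iff p2.ne']; linear_combination e2'
    rw [a1, a2] at h1
    have p3 : (1 - x ^ 2) ≠ 0 := by
      rw [show 1 - x ^ 2 = (1 - x) * (1 + x) by ring]; positivity
    rw [weight, eq_div_iff (by positivity)]
    calc _ = (1 - x ^ 2) * (polyIntegral (Lagrange.basis (nodes N) id x)
          * (derivative (legendre N)).eval x ^ 2) := by ring
      _ = _ := by rw [← h1]; field_simp; ring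
  · intro y hy hyx
    rw [hv']; simp [huy y hy hyx]
  · exact fun h => absurd hx h

/-- Gauss-Legendre quadrature is exact on polynomials of degree `< 2 * N`. -/
theorem sum_weight_mul_eval {N : ℕ} {f : ℝ[X]} (hf : f.degree < (2 * N : ℕ)) :
    ∑ x ∈ nodes N, weight N x * f.eval x = polyIntegral f := by
  rw [polyIntegral_eq_sum_basis hf]
  exact Finset.sum_congr rfl fun x hx => by rw [polyIntegral_basis hx]

end GaussLegendre

/-! ### Quadrature error on Chebyshev polynomials. -/

namespace GaussLegendre

open Polynomial

/-- The error of Gauss-Legendre quadrature on a real polynomial. -/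
noncomputable def quadratureError (N : ℕ) (p : ℝ[X]) : ℝ :=
  polyIntegral p - ∑ x ∈ nodes N, weight N x * p.eval x

lemma quadratureError_add (N : ℕ) (p q : ℝ[X]) :
    quadratureError N (p + q) = quadratureError N p + quadratureError N q := by
  simp only [quadratureError, map_add, eval_add, mul_add, Finset.sum_add_distrib]; ring

lemma quadratureError_eq_zero {N : ℕ} {p : ℝ[X]} (hp : p.degree < (2 * N : ℕ)) :
    quadratureError N p = 0 := by
  rw [quadratureError, sum_weight_mul_eval hp, sub_self]

lemma quadratureError_C_mul_legendre_sq (N : ℕ) (c : ℝ) :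
    quadratureError N (C c * legendre N ^ 2) = c * polyIntegral (legendre N ^ 2) := by
  rw [quadratureError, polyIntegral_C_mul, Finset.sum_eq_zero, sub_zero]
  intro x hx
  simp [mem_nodes.mp hx]

lemma iterate_derivative_comp_neg_X (p : ℝ[X]) (k : ℕ) :
    derivative^[k] (p.comp (-X)) = C ((-1) ^ k) * (derivative^[k] p).comp (-X) := by
  induction k with
  | zero => simp
  | succ k ih =>
    rw [Function.iterate_succ_apply', ih, Function.iterate_succ_apply', derivative_C_mul,
      derivative_comp, pow_succ]
    simp

lemma legendre_comp_neg_X (N : ℕ) : (legendre N).comp (-X) = C ((-1) ^ N) * legendre N := by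
  have h := iterate_derivative_comp_neg_X ((X ^ 2 - 1) ^ N) N
  have h1 : ((X ^ 2 - 1) ^ N : ℝ[X]).comp (-X) = (X ^ 2 - 1) ^ N := by simp
  have h2 : (C ((-1) ^ N) * C ((-1) ^ N) : ℝ[X]) = 1 := by
    rw [← C_mul, ← mul_pow]; simp
  rw [h1] at h
  rw [legendre, mul_comp, C_comp]
  linear_combination (-(C (1 / (2 ^ N * (N.factorial : ℝ))) : ℝ[X])
    * (derivative^[N] ((X ^ 2 - 1) ^ N)).comp (-X)) * h2
    - C (1 / (2 ^ N * (N.factorial : ℝ))) * C ((-1) ^ N) * h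

lemma legendre_eval_neg (N : ℕ) (x : ℝ) :
    (legendre N).eval (-x) = (-1) ^ N * (legendre N).eval x := by
  have := congrArg (eval x) (legendre_comp_neg_X N)
  simpa [eval_comp] using this

lemma derivative_legendre_eval_neg (N : ℕ) (x : ℝ) :
    (derivative (legendre N)).eval (-x) = -((-1) ^ N * (derivative (legendre N)).eval x) := by
  have := congrArg (fun p => eval x (derivative p)) (legendre_comp_neg_X N)
  simp only [derivative_comp, derivative_C_mul] at this
  simp [eval_comp] at this
  linarith

lemma neg_mem_nodes {N : ℕ} {x : ℝ} (hx : x ∈ nodes N) : -x ∈ nodes N := by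
  rw [mem_nodes] at hx ⊢
  rw [legendre_eval_neg, hx, mul_zero]

lemma weight_neg (N : ℕ) (x : ℝ) : weight N (-x) = weight N x := by
  rw [weight, weight, derivative_legendre_eval_neg, neg_sq, neg_sq, mul_pow, ← pow_mul,
    mul_comm N 2, pow_mul]
  simp

lemma sum_weight_mul_eq_zero_of_odd {N : ℕ} {f : ℝ → ℝ} (hf : ∀ x, f (-x) = -f x) :
    ∑ x ∈ nodes N, weight N x * f x = 0 := by
  have h : ∑ x ∈ nodes N, weight N x * f x = ∑ x ∈ nodes N, weight N (-x) * f (-x) :=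
    Finset.sum_bij' (fun x _ => -x) (fun x _ => -x) (fun x hx => neg_mem_nodes hx)
      (fun x hx => neg_mem_nodes hx) (by simp) (by simp) (by simp)
  simp only [weight_neg, hf, mul_neg, Finset.sum_neg_distrib] at h
  linarith

lemma sum_weight {N : ℕ} (hN : N ≠ 0) : ∑ x ∈ nodes N, weight N x = 2 := by
  have h : (1 : ℝ[X]).degree < (2 * N : ℕ) := by
    rw [degree_one]; exact_mod_cast (by omega : 0 < 2 * N)
  have := sum_weight_mul_eval h
  simp only [eval_one, mul_one] at this
  rw [this, polyIntegral_apply]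
  norm_num

open Polynomial.Chebyshev in
lemma abs_sum_weight_mul_T_le {N : ℕ} (hN : N ≠ 0) (n : ℤ) :
    |∑ x ∈ nodes N, weight N x * (T ℝ n).eval x| ≤ 2 := by
  refine (Finset.abs_sum_le_sum_abs _ _).trans ?_
  rw [← sum_weight hN]
  refine Finset.sum_le_sum fun x hx => ?_
  rw [abs_mul, abs_of_pos (weight_pos hx)]
  have h := mem_Ioo_of_mem_nodes hx
  exact mul_le_of_le_one_right (weight_pos hx).le
    (abs_eval_T_real_le_one n (abs_le.mpr ⟨h.1.le, h.2.le⟩))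

open Polynomial.Chebyshev in
-- An antiderivative comes from `2 * T n = U n - U (n - 2)` and `T k' = k * U (k - 1)`.
lemma polyIntegral_T {n : ℕ} (hn : 2 ≤ n) :
    polyIntegral (T ℝ n) = -(1 + (-1) ^ n) / (n ^ 2 - 1) := by
  have hn' : (2 : ℝ) ≤ n := by exact_mod_cast hn
  have h1 : (n : ℝ) + 1 ≠ 0 := by linarith
  have h2 : (n : ℝ) - 1 ≠ 0 := by linarith
  have h3 : (n : ℝ) ^ 2 - 1 ≠ 0 := by
    rw [show (n : ℝ) ^ 2 - 1 = (n + 1) * (n - 1) by ring]; exact mul_ne_zero h1 h2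
  have hd : T ℝ n = derivative (Polynomial.C (1 / (2 * ((n : ℝ) + 1))) * T ℝ (n + 1)
      - Polynomial.C (1 / (2 * ((n : ℝ) - 1))) * T ℝ (n - 1)) := by
    rw [derivative_sub, derivative_C_mul, derivative_C_mul, T_derivative_eq_U, T_derivative_eq_U]
    have h := two_mul_T_eq_U_sub_U ℝ ((n : ℤ) - 2)
    rw [sub_add_cancel] at h
    rw [show (n : ℤ) + 1 - 1 = n by ring, show (n : ℤ) - 1 - 1 = n - 2 by ring]
    have e1 : (((n : ℤ) + 1 : ℤ) : ℝ[X]) = Polynomial.C ((n : ℝ) + 1) := by simp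
    have e2 : (((n : ℤ) - 1 : ℤ) : ℝ[X]) = Polynomial.C ((n : ℝ) - 1) := by simp
    rw [e1, e2, ← mul_assoc, ← mul_assoc, ← Polynomial.C_mul, ← Polynomial.C_mul,
      show 1 / (2 * ((n : ℝ) + 1)) * (n + 1) = 1 / 2 by field_simp,
      show 1 / (2 * ((n : ℝ) - 1)) * (n - 1) = 1 / 2 by field_simp, ← mul_sub, ← h,
      ← mul_assoc, ← Polynomial.C_ofNat, ← Polynomial.C_mul]
    norm_num
  rw [hd, polyIntegral_derivative]
  simp only [eval_sub, eval_mul, eval_C, T_eval_one, T_eval_neg_one]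
  have s1 : (((n : ℤ) + 1).negOnePow : ℝ) = -(-1) ^ n := by
    rw [Int.negOnePow_succ]; simp [Int.negOnePow_def]
  have s2 : (((n : ℤ) - 1).negOnePow : ℝ) = -(-1) ^ n := by
    rw [Int.negOnePow_sub]; simp [Int.negOnePow_def]
  simp only [Int.coe_negOnePow] at *
  rw [s1, s2]
  field_simp
  ring

open Polynomial.Chebyshev in
lemma quadratureError_T_of_odd (N : ℕ) {n : ℕ} (hn : Odd n) : quadratureError N (T ℝ n) = 0 := by
  have hodd : ∀ x : ℝ, (T ℝ n).eval (-x) = -(T ℝ n).eval x := fun x => by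
    rw [T_eval_neg, Int.negOnePow_odd _ (by exact_mod_cast hn)]; simp
  have hint : polyIntegral (T ℝ n) = 0 := by
    rcases Nat.lt_or_ge n 2 with h | h
    · obtain rfl : n = 1 := by obtain ⟨k, hk⟩ := hn; omega
      rw [polyIntegral_apply]; simp
    · rw [polyIntegral_T h, hn.neg_one_pow]; simp
  rw [quadratureError, hint, sum_weight_mul_eq_zero_of_odd hodd, sub_zero]

open Polynomial.Chebyshev in
-- The constant is `2 + 2 / 15`: the positive weights sum to `2` and `|T n| ≤ 1` at the nodes, while
-- the integral is at most `2 / (n ^ 2 - 1)` with `n ^ 2 - 1 ≥ 15`.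
lemma abs_quadratureError_T_le {N n : ℕ} (hN : N ≠ 0) (hn : 4 ≤ n) :
    |quadratureError N (T ℝ n)| ≤ 32 / 15 := by
  have hn' : (4 : ℝ) ≤ n := by exact_mod_cast hn
  have h1 : |polyIntegral (T ℝ n)| ≤ 2 / 15 := by
    rw [polyIntegral_T (by omega), abs_div, abs_neg]
    have h2 : (15 : ℝ) ≤ n ^ 2 - 1 := by nlinarith
    rw [abs_of_pos (by linarith : (0 : ℝ) < n ^ 2 - 1)]
    gcongr
    rcases neg_one_pow_eq_or ℝ n with h | h <;> rw [h] <;> norm_num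
  have h2 := abs_sum_weight_mul_T_le hN (n : ℤ)
  rw [quadratureError]
  refine (abs_sub _ _).trans ?_
  linarith

lemma integral_one_sub_sq_pow (N : ℕ) :
    ∫ x in (-1 : ℝ)..1, (1 - x ^ 2) ^ N = 2 * ∏ i ∈ Finset.range N, (2 * (i : ℝ) + 2) / (2 * i + 3) := by
  rw [← integral_sin_pow_odd]
  have := integral_sin_pow_odd_mul_cos_pow (a := 0) (b := Real.pi) N 0
  simp only [pow_zero, mul_one, one_mul, Real.cos_pi, Real.cos_zero] at this
  exact this.symm

lemma four_pow_mul_factorial_sq_div (N : ℕ) :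
    (4 : ℝ) ^ N * (N.factorial : ℝ) ^ 2 / (2 * N).factorial
      = ∏ i ∈ Finset.range N, (2 * (i : ℝ) + 2) / (2 * i + 1) := by
  induction N with
  | zero => simp
  | succ k ih =>
    rw [Finset.prod_range_succ, ← ih, show 2 * (k + 1) = 2 * k + 1 + 1 by ring,
      Nat.factorial_succ, Nat.factorial_succ, Nat.factorial_succ]
    push_cast
    field_simp
    ring

/-- Rodrigues' formula moves `N` derivatives onto the other factor, leaving a constant times the
integral of `(1 - x ^ 2) ^ N`. -/
lemma polyIntegral_legendre_sq (N : ℕ) :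
    polyIntegral (legendre N ^ 2) = (legendre N).coeff N / 2 ^ N *
      (2 * ∏ i ∈ Finset.range N, (2 * (i : ℝ) + 2) / (2 * i + 3)) := by
  have h : derivative^[N] (legendre N) = C (N.factorial * (legendre N).coeff N) := by
    have hd : (derivative^[N] (legendre N)).natDegree = 0 := by
      have := natDegree_iterate_derivative (legendre N) N
      rw [natDegree_legendre] at this; omega
    rw [eq_C_of_natDegree_eq_zero hd, coeff_iterate_derivative]
    simp [Nat.descFactorial_self]
  have hi : (-1) ^ N * polyIntegral ((X ^ 2 - 1) ^ N)
      = 2 * ∏ i ∈ Finset.range N, (2 * (i : ℝ) + 2) / (2 * i + 3) := by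
    rw [← integral_one_sub_sq_pow, polyIntegral_apply, ← intervalIntegral.integral_const_mul]
    refine intervalIntegral.integral_congr fun x _ => ?_
    simp only [eval_pow, eval_sub, eval_X, eval_one, ← mul_pow]
    congr 1; ring
  rw [pow_two, polyIntegral_legendre_mul, h, mul_comm _ (C _), polyIntegral_C_mul, ← hi]
  field_simp

open Polynomial.Chebyshev in
-- Subtracting `c * P_N ^ 2`, with `c` the ratio of leading coefficients, lowers the degree below `2
-- * N`. Since `P_N ^ 2` vanishes at the nodes, the error is `c` times its integral.
lemma quadratureError_T_two_mul {N : ℕ} (hN : N ≠ 0) :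
    quadratureError N (T ℝ (2 * N : ℕ)) = Real.Wallis.W N := by
  set a := (legendre N).coeff N with ha
  have ha0 : 0 < a := coeff_legendre_pos N
  set c : ℝ := 2 ^ (2 * N - 1) / a ^ 2 with hc
  have hc0 : c ≠ 0 := by positivity
  have hlc : (legendre N).leadingCoeff = a := by rw [leadingCoeff, natDegree_legendre]
  have hdeg : (T ℝ (2 * N : ℕ) - C c * legendre N ^ 2).degree < (2 * N : ℕ) := by
    have hT : (T ℝ (2 * N : ℕ)).degree = (2 * N : ℕ) := by rw [degree_T, Int.natAbs_natCast]
    have hP : (C c * legendre N ^ 2).degree = (2 * N : ℕ) := by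
      rw [degree_C_mul hc0, degree_eq_natDegree (pow_ne_zero 2 (legendre_ne_zero N)),
        natDegree_pow, natDegree_legendre]
    rw [← hT]
    refine degree_sub_lt_left (hT.trans hP.symm) (T_ne_zero ℝ _) ?_
    rw [leadingCoeff_T, Int.natAbs_natCast, leadingCoeff_mul, leadingCoeff_C, leadingCoeff_pow, hlc, hc,
      div_mul_cancel₀ _ (by positivity)]
  have h := quadratureError_add N (T ℝ (2 * N : ℕ) - C c * legendre N ^ 2) (C c * legendre N ^ 2)
  rw [sub_add_cancel, quadratureError_eq_zero hdeg, zero_add,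
    quadratureError_C_mul_legendre_sq, polyIntegral_legendre_sq] at h
  rw [h, Real.Wallis.W, Finset.prod_mul_distrib, ← four_pow_mul_factorial_sq_div, hc, ← ha]
  have h2 : (2 : ℝ) ^ (2 * N - 1) * 2 = 4 ^ N := by
    rw [← pow_succ, Nat.sub_add_cancel (by omega), pow_mul]; norm_num
  have h3 : 4 ^ N * (N.factorial : ℝ) ^ 2 / (2 * N).factorial = 2 ^ N / a := by
    rw [ha, coeff_legendre, show (4 : ℝ) ^ N = 2 ^ N * 2 ^ N by rw [← mul_pow]; norm_num]
    field_simp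
  rw [h3]
  have h4 : (4 : ℝ) ^ N = 2 ^ N * 2 ^ N := by rw [← mul_pow]; norm_num
  rw [h4] at h2
  field_simp
  linear_combination h2

open Polynomial.Chebyshev in
lemma quadratureError_T_of_lt {N n : ℕ} (hn : n < 2 * N) : quadratureError N (T ℝ n) = 0 := by
  apply quadratureError_eq_zero
  rw [degree_T]
  exact_mod_cast hn

end GaussLegendre

/-! ### Chebyshev expansions from Laurent series. -/

namespace GaussLegendre

open Complex Metric Set

/-- The `k`-th Laurent coefficient of `F`, computed on the circle of radius `R`. -/
noncomputable def laurentCoeff (F : ℂ → ℂ) (R : ℝ) (k : ℤ) : ℂ :=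
  (2 * Real.pi * I : ℂ)⁻¹ • ∮ w in C(0, R), (w - 0)⁻¹ • (w ^ (-k) * F w)

lemma laurentCoeff_eq_of_le {F : ℂ → ℂ} {r R : ℝ} (hr : 0 < r) (hrR : r ≤ R)
    (hF : ∀ w : ℂ, r ≤ ‖w‖ → ‖w‖ ≤ R → DifferentiableAt ℂ F w) (k : ℤ) :
    laurentCoeff F R k = laurentCoeff F r k := by
  have hd : ∀ w : ℂ, r ≤ ‖w‖ → ‖w‖ ≤ R → DifferentiableAt ℂ (fun w => w ^ (-k) * F w) w := by
    intro w h1 h2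
    have hw : w ≠ 0 := norm_pos_iff.mp (hr.trans_le h1)
    exact (differentiableAt_zpow.mpr (Or.inl hw)).mul (hF w h1 h2)
  rw [laurentCoeff, laurentCoeff,
    circleIntegral_sub_center_inv_smul_eq_of_differentiable_on_annulus_off_countable hr hrR
      countable_empty]
  · intro w hw
    simp only [mem_sdiff, mem_closedBall, mem_ball, dist_zero_right, not_lt] at hw
    exact (hd w hw.2 hw.1).continuousAt.continuousWithinAt
  · intro w hw
    simp only [mem_sdiff, mem_closedBall, mem_ball, dist_zero_right, not_le] at hw
    exact hd w hw.1.2.le hw.1.1.le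

lemma norm_laurentCoeff_le {F : ℂ → ℂ} {R K : ℝ} (hR : 0 < R)
    (hF : ∀ w : ℂ, ‖w‖ = R → ‖F w‖ ≤ K) (k : ℤ) : ‖laurentCoeff F R k‖ ≤ K * R ^ (-k) := by
  have h := circleIntegral.norm_two_pi_i_inv_smul_integral_le_of_norm_le_const (c := 0) (R := R)
    (f := fun w => (w - 0)⁻¹ • (w ^ (-k) * F w)) (C := R⁻¹ * (R ^ (-k) * K)) hR.le (by
      intro w hw
      rw [mem_sphere_zero_iff_norm] at hw
      rw [sub_zero, norm_smul, norm_inv, norm_mul, norm_zpow, hw]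
      gcongr
      exact hF w hw)
  refine h.trans_eq ?_
  field_simp

/-- The contour can be moved to radius `ρ` for `k ≥ 0` and to `ρ⁻¹` for `k ≤ 0`, where the trivial
estimate decays. -/
lemma norm_laurentCoeff_one_le {F : ℂ → ℂ} {ρ K : ℝ} (hρ : 1 < ρ)
    (hF : ∀ w : ℂ, ρ⁻¹ ≤ ‖w‖ → ‖w‖ ≤ ρ → DifferentiableAt ℂ F w)
    (hK : ∀ w : ℂ, ρ⁻¹ ≤ ‖w‖ → ‖w‖ ≤ ρ → ‖F w‖ ≤ K) (k : ℤ) :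
    ‖laurentCoeff F 1 k‖ ≤ K * (ρ⁻¹) ^ k.natAbs := by
  have h0 : 0 < ρ := one_pos.trans hρ
  have h1 : ρ⁻¹ ≤ 1 := inv_le_one_of_one_le₀ hρ.le
  rcases le_total 0 k with hk | hk
  · rw [← laurentCoeff_eq_of_le one_pos hρ.le (fun w a b => hF w (h1.trans a) b)]
    refine (norm_laurentCoeff_le h0 (fun w hw => hK w (hw ▸ h1.trans hρ.le) hw.le) k).trans_eq ?_
    rw [← zpow_natCast, Int.natAbs_of_nonneg hk, inv_zpow']
  · rw [laurentCoeff_eq_of_le (inv_pos.mpr h0) h1 (fun w a b => hF w a (b.trans hρ.le))]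
    refine (norm_laurentCoeff_le (inv_pos.mpr h0)
      (fun w hw => hK w hw.ge (hw ▸ h1.trans hρ.le)) k).trans_eq ?_
    rw [← zpow_natCast, Int.ofNat_natAbs_of_nonpos hk]

lemma summable_geometric_natAbs {t : ℝ} (h0 : 0 ≤ t) (h1 : t < 1) :
    Summable fun k : ℤ => t ^ k.natAbs := by
  refine Summable.of_nat_of_neg ?_ ?_ <;>
  simpa using summable_geometric_of_lt_one h0 h1

/-- A function analytic on a closed annulus around the unit circle is the sum of its Laurent
series on the unit circle. -/
lemma hasSum_laurentCoeff {F : ℂ → ℂ} {ρ K : ℝ} (hρ : 1 < ρ)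
    (hF : ∀ w : ℂ, ρ⁻¹ ≤ ‖w‖ → ‖w‖ ≤ ρ → DifferentiableAt ℂ F w)
    (hK : ∀ w : ℂ, ρ⁻¹ ≤ ‖w‖ → ‖w‖ ≤ ρ → ‖F w‖ ≤ K) (θ : ℝ) :
    HasSum (fun k : ℤ => laurentCoeff F 1 k * exp (k * θ * I)) (F (exp (θ * I))) := by
  have h1 : ρ⁻¹ ≤ 1 := inv_le_one_of_one_le₀ hρ.le
  have hlt : ρ⁻¹ < 1 := inv_lt_one_of_one_lt₀ hρ
  have : Fact (0 < 2 * Real.pi) := ⟨Real.two_pi_pos⟩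
  have hcont : Continuous fun x : AddCircle (2 * Real.pi) => F (AddCircle.toCircle x) := by
    refine continuous_iff_continuousAt.mpr fun x => ContinuousAt.comp (g := F) ?_ ?_
    · refine (hF _ ?_ ?_).continuousAt <;> rw [Circle.norm_coe]
      · exact h1
      · exact hρ.le
    · exact (continuous_induced_dom.comp AddCircle.continuous_toCircle).continuousAt
  set f : C(AddCircle (2 * Real.pi), ℂ) := ⟨_, hcont⟩ with hf
  have hfour : ∀ (k : ℤ) (x : ℝ), fourier k (x : AddCircle (2 * Real.pi)) = exp (k * x * I) := by
    intro k x
    rw [fourier_coe_apply]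
    congr 1
    have : (Real.pi : ℂ) ≠ 0 := ofReal_ne_zero.mpr Real.pi_ne_zero
    push_cast
    field_simp
  have hfx : ∀ x : ℝ, f (x : AddCircle (2 * Real.pi)) = F (exp (x * I)) := by
    intro x
    have := hfour 1 x
    rw [fourier_one] at this
    simp only [hf, ContinuousMap.coe_mk, this]
    simp
  -- On the unit circle Laurent coefficients are Fourier coefficients; their summability gives
  -- pointwise convergence.
  have hcoeff : ∀ k, fourierCoeff f k = laurentCoeff F 1 k := by
    intro k
    rw [fourierCoeff_eq_intervalIntegral f k 0, laurentCoeff, circleIntegral, zero_add,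
      mul_inv, mul_smul, ← intervalIntegral.integral_smul I⁻¹, ← coe_smul]
    congr 1
    · push_cast; rw [one_div]
    · refine intervalIntegral.integral_congr fun x _ => ?_
      have hx : circleMap 0 1 x = exp (x * I) := by simp [circleMap]
      have he : exp (x * I) ≠ 0 := exp_ne_zero _
      simp only [hfour, hfx, deriv_circleMap, hx, sub_zero, smul_eq_mul, ← exp_int_mul]
      field_simp
  have hsum : Summable (fourierCoeff f) := by
    refine Summable.of_norm_bounded
      ((summable_geometric_natAbs (inv_nonneg.mpr (by linarith)) hlt).mul_left K) fun k => ?_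
    rw [hcoeff]
    exact norm_laurentCoeff_one_le hρ hF hK k
  have := has_pointwise_sum_fourier_series_of_summable hsum (θ : AddCircle (2 * Real.pi))
  rw [hfx] at this
  simpa only [hcoeff, hfour, smul_eq_mul] using this

/-- The two terms are `(w ∓ 1) ^ 2 / (2 * w)`, so this is the parallelogram law for `w` and `1`. -/
lemma norm_joukowsky_add_norm_joukowsky {w : ℂ} (hw : w ≠ 0) :
    ‖(w + w⁻¹) / 2 - 1‖ + ‖(w + w⁻¹) / 2 + 1‖ = ‖w‖ + ‖w‖⁻¹ := by
  have e1 : (w + w⁻¹) / 2 - 1 = (w - 1) ^ 2 / (2 * w) := by field_simp; ring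
  have e2 : (w + w⁻¹) / 2 + 1 = (w + 1) ^ 2 / (2 * w) := by field_simp; ring
  have hn : ‖w‖ ≠ 0 := norm_ne_zero_iff.mpr hw
  have hp := parallelogram_law_with_norm ℝ w 1
  rw [e1, e2, norm_div, norm_div, norm_pow, norm_pow, norm_mul, norm_ofNat]
  rw [norm_one] at hp
  field_simp
  linarith

lemma add_inv_le_add_inv {ρ t : ℝ} (hρ : 1 < ρ) (h1 : ρ⁻¹ ≤ t) (h2 : t ≤ ρ) :
    t + t⁻¹ ≤ ρ + ρ⁻¹ := by
  have h0 : 0 < ρ := one_pos.trans hρ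
  have ht : 0 < t := (inv_pos.mpr h0).trans_le h1
  have h3 : 1 ≤ t * ρ := by
    have := mul_le_mul_of_nonneg_right h1 h0.le
    rwa [inv_mul_cancel₀ h0.ne'] at this
  have : ρ + ρ⁻¹ - (t + t⁻¹) = (ρ - t) * (t * ρ - 1) / (t * ρ) := by field_simp; ring
  have h4 : 0 ≤ (ρ - t) * (t * ρ - 1) / (t * ρ) :=
    div_nonneg (mul_nonneg (by linarith) (by linarith)) (by positivity)
  linarith

open Polynomial.Chebyshev in
/-- The Chebyshev expansion on `[-1, 1]` of a function analytic on a closed Bernstein ellipse, with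
geometric decay of the coefficients. The term of index `0` is counted twice. -/
theorem exists_hasSum_chebyshev {h : ℂ → ℂ} {ρ K : ℝ} (hρ : 1 < ρ)
    (hd : ∀ z : ℂ, ‖z - 1‖ + ‖z + 1‖ ≤ ρ + ρ⁻¹ → DifferentiableAt ℂ h z)
    (hK : ∀ z : ℂ, ‖z - 1‖ + ‖z + 1‖ ≤ ρ + ρ⁻¹ → ‖h z‖ ≤ K) :
    ∃ (a : ℕ → ℂ) (b : ℂ), (∀ n, ‖a n‖ ≤ 2 * K * ρ⁻¹ ^ n) ∧
      ∀ x : ℝ, x ∈ Icc (-1) 1 →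
        HasSum (fun n : ℕ => a n * ((T ℝ n).eval x : ℝ)) (h x + b) := by
  have h0 : 0 < ρ := one_pos.trans hρ
  have hw0 : ∀ w : ℂ, ρ⁻¹ ≤ ‖w‖ → w ≠ 0 := fun w h1 =>
    norm_pos_iff.mp ((inv_pos.mpr h0).trans_le h1)
  have hell : ∀ w : ℂ, ρ⁻¹ ≤ ‖w‖ → ‖w‖ ≤ ρ →
      ‖(w + w⁻¹) / 2 - 1‖ + ‖(w + w⁻¹) / 2 + 1‖ ≤ ρ + ρ⁻¹ := fun w h1 h2 => by
    rw [norm_joukowsky_add_norm_joukowsky (hw0 w h1)]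
    exact add_inv_le_add_inv hρ h1 h2
  set F : ℂ → ℂ := fun w => h ((w + w⁻¹) / 2) with hF
  have hFd : ∀ w : ℂ, ρ⁻¹ ≤ ‖w‖ → ‖w‖ ≤ ρ → DifferentiableAt ℂ F w := fun w h1 h2 =>
    (hd _ (hell w h1 h2)).comp w ((differentiableAt_id.add
      (differentiableAt_inv (hw0 w h1))).div_const 2)
  have hFK : ∀ w : ℂ, ρ⁻¹ ≤ ‖w‖ → ‖w‖ ≤ ρ → ‖F w‖ ≤ K := fun w h1 h2 => hK _ (hell w h1 h2)
  set c : ℤ → ℂ := laurentCoeff F 1 with hc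
  -- The indices `n` and `-n` are paired; at `n = 0` this counts `c 0` twice, which `b = c 0`
  -- compensates.
  refine ⟨fun n => c n + c (-n), c 0, fun n => ?_, fun x hx => ?_⟩
  · have h1 := norm_laurentCoeff_one_le hρ hFd hFK n
    have h2 := norm_laurentCoeff_one_le hρ hFd hFK (-n)
    rw [Int.natAbs_neg, Int.natAbs_natCast] at h2
    rw [Int.natAbs_natCast] at h1
    exact (norm_add_le _ _).trans (by linarith)
  · set θ := Real.arccos x with hθ
    have hcos : Real.cos θ = x := Real.cos_arccos hx.1 hx.2
    have hFθ : ∀ t : ℝ, F (exp (t * I)) = h (Real.cos t : ℝ) := fun t => by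
      simp only [hF]
      rw [← exp_neg, ofReal_cos, Complex.cos, neg_mul]
    have s1 := hasSum_laurentCoeff hρ hFd hFK θ
    -- Averaging the series at `θ` and `-θ` replaces exponentials by cosines.
    have s2 := hasSum_laurentCoeff hρ hFd hFK (-θ)
    rw [hFθ] at s1 s2
    rw [Real.cos_neg] at s2
    have s3 := ((s1.add s2).div_const 2).nat_add_neg
    rw [hcos] at s3
    convert! s3 using 1
    · ext n
      have hT : (((T ℝ n).eval x : ℝ) : ℂ) = (exp (n * θ * I) + exp (-(n * θ * I))) / 2 := by
        rw [← hcos, T_real_cos, ofReal_cos, Complex.cos]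
        push_cast
        simp only [neg_mul]
      rw [hT]
      have e1 : ((-(n : ℤ) : ℤ) : ℂ) * θ * I = -(n * θ * I) := by push_cast; ring
      have e2 : ((n : ℤ) : ℂ) * ((-θ : ℝ) : ℂ) * I = -(n * θ * I) := by push_cast; ring
      have e3 : ((-(n : ℤ) : ℤ) : ℂ) * ((-θ : ℝ) : ℂ) * I = n * θ * I := by push_cast; ring
      rw [e1, e2, e3, Int.cast_natCast]
      simp only [hc]
      ring
    · simp only [hc, Int.cast_zero, zero_mul, exp_zero]
      ring

end GaussLegendre

/-! ### Error bound for analytic integrands. -/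

namespace GaussLegendre

open Complex Set

lemma mem_bernstein_of_mem_Icc {x ρ : ℝ} (hρ : 1 < ρ) (hx : x ∈ Icc (-1 : ℝ) 1) :
    ‖(x : ℂ) - 1‖ + ‖(x : ℂ) + 1‖ ≤ ρ + ρ⁻¹ := by
  have e1 : ‖(x : ℂ) - 1‖ = 1 - x := by
    rw [show (x : ℂ) - 1 = ((x - 1 : ℝ) : ℂ) by push_cast; ring, norm_real, Real.norm_eq_abs,
      abs_of_nonpos (by linarith [hx.2])]
    ring
  have e2 : ‖(x : ℂ) + 1‖ = 1 + x := by
    rw [show (x : ℂ) + 1 = ((x + 1 : ℝ) : ℂ) by push_cast; ring, norm_real, Real.norm_eq_abs,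
      abs_of_nonneg (by linarith [hx.1])]
    ring
  have h3 : (1 : ℝ) + 1⁻¹ ≤ ρ + ρ⁻¹ := add_inv_le_add_inv hρ (inv_le_one_of_one_le₀ hρ.le) hρ.le
  rw [e1, e2]
  norm_num at h3
  linarith

open Polynomial.Chebyshev in
-- Domination by a geometric series permits integration term by term. The constant `b` drops out
-- because the weights sum to `2`, which needs `N ≠ 0`.
lemma hasSum_quadratureError {N : ℕ} (hN : N ≠ 0) {h : ℂ → ℂ} {a : ℕ → ℂ} {b : ℂ} {C t : ℝ}
    (ht0 : 0 ≤ t) (ht1 : t < 1)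
    (hint : IntervalIntegrable (fun x : ℝ => h x) MeasureTheory.volume (-1) 1)
    (ha : ∀ n, ‖a n‖ ≤ C * t ^ n)
    (hs : ∀ x : ℝ, x ∈ Icc (-1) 1 → HasSum (fun n : ℕ => a n * ((T ℝ n).eval x : ℝ)) (h x + b)) :
    HasSum (fun n : ℕ => a n * (quadratureError N (T ℝ n) : ℂ))
      ((∫ x in (-1 : ℝ)..1, h x) - quadrature N h) := by
  have h1 : HasSum (fun n : ℕ => ∫ x in (-1 : ℝ)..1, a n * ((T ℝ n).eval x : ℝ))
      (∫ x in (-1 : ℝ)..1, (h x + b)) := by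
    refine intervalIntegral.hasSum_integral_of_dominated_convergence (fun n _ => C * t ^ n)
      (fun n => ?_) (fun n => ?_) ?_ intervalIntegrable_const ?_
    · exact (continuous_const.mul
        (continuous_ofReal.comp (Polynomial.continuous _))).aestronglyMeasurable
    · refine Filter.Eventually.of_forall fun x hx => ?_
      rw [uIoc_of_le (by norm_num)] at hx
      rw [norm_mul, norm_real, Real.norm_eq_abs]
      exact (mul_le_of_le_one_right (norm_nonneg _)
        (abs_eval_T_real_le_one n (abs_le.mpr ⟨hx.1.le, hx.2⟩))).trans (ha n)
    · exact Filter.Eventually.of_forall fun x _ =>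
        (summable_geometric_of_lt_one ht0 ht1).mul_left C
    · refine Filter.Eventually.of_forall fun x hx => ?_
      rw [uIoc_of_le (by norm_num)] at hx
      exact hs x ⟨hx.1.le, hx.2⟩
  have h2 : HasSum (fun n : ℕ => ∑ x ∈ nodes N, (weight N x : ℂ) * (a n * ((T ℝ n).eval x : ℝ)))
      (∑ x ∈ nodes N, (weight N x : ℂ) * (h x + b)) :=
    hasSum_sum fun x hx => (hs x ⟨(mem_Ioo_of_mem_nodes hx).1.le,
      (mem_Ioo_of_mem_nodes hx).2.le⟩).mul_left _
  convert! h1.sub h2 using 1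
  · ext n
    rw [quadratureError, polyIntegral_apply, intervalIntegral.integral_const_mul,
      intervalIntegral.integral_ofReal, ofReal_sub, mul_sub, ofReal_sum, Finset.mul_sum]
    congr 1
    refine Finset.sum_congr rfl fun x _ => ?_
    push_cast
    ring
  · rw [intervalIntegral.integral_add hint intervalIntegrable_const]
    simp only [mul_add, Finset.sum_add_distrib, ← Finset.sum_mul, ← ofReal_sum, sum_weight hN]
    rw [intervalIntegral.integral_const, quadrature, real_smul]
    push_cast
    ring

/-- The error of `N`-point Gauss-Legendre quadrature on a function analytic on a closed Bernstein
ellipse. -/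
theorem norm_integral_sub_quadrature_le {h : ℂ → ℂ} {ρ K : ℝ} (N : ℕ) (hρ : 1 < ρ)
    (hd : ∀ z : ℂ, ‖z - 1‖ + ‖z + 1‖ ≤ ρ + ρ⁻¹ → DifferentiableAt ℂ h z)
    (hK : ∀ z : ℂ, ‖z - 1‖ + ‖z + 1‖ ≤ ρ + ρ⁻¹ → ‖h z‖ ≤ K) :
    ‖(∫ x in (-1 : ℝ)..1, h x) - quadrature N h‖
      ≤ K * (Real.pi + 64 / (15 * (ρ ^ 2 - 1))) * (ρ⁻¹ ^ 2) ^ N := by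
  have h0 : 0 < ρ := one_pos.trans hρ
  have hK0 : 0 ≤ K := (norm_nonneg _).trans
    (hK ((0 : ℝ) : ℂ) (mem_bernstein_of_mem_Icc hρ ⟨by norm_num, by norm_num⟩))
  have hρ2 : 0 < ρ ^ 2 - 1 := by nlinarith
  have htail : 0 < 64 / (15 * (ρ ^ 2 - 1)) := by positivity
  rcases eq_or_ne N 0 with rfl | hN
  -- The empty rule is not exact on constants, so this case uses the crude bound `2 * K ≤ π * K`.
  · have hq : quadrature 0 h = 0 := by
      rw [quadrature, Finset.card_eq_zero.mp (card_nodes 0), Finset.sum_empty]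
    have hI : ‖∫ x in (-1 : ℝ)..1, h x‖ ≤ K * |1 - (-1)| :=
      intervalIntegral.norm_integral_le_of_norm_le_const fun x hx => by
        rw [uIoc_of_le (by norm_num)] at hx
        exact hK _ (mem_bernstein_of_mem_Icc hρ ⟨hx.1.le, hx.2⟩)
    rw [hq, sub_zero, pow_zero, mul_one]
    refine hI.trans (mul_le_mul_of_nonneg_left ?_ hK0)
    have := Real.pi_gt_three
    norm_num
    linarith
  obtain ⟨a, b, ha, hs⟩ := exists_hasSum_chebyshev hρ hd hK
  set t : ℝ := ρ⁻¹ with ht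
  have ht0 : 0 < t := inv_pos.mpr h0
  have ht1 : t < 1 := inv_lt_one_of_one_lt₀ hρ
  have ht2 : t ^ 2 < 1 := by nlinarith
  have hint : IntervalIntegrable (fun x : ℝ => h x) MeasureTheory.volume (-1) 1 := by
    refine ContinuousOn.intervalIntegrable fun x hx => ?_
    rw [uIcc_of_le (by norm_num)] at hx
    exact ((hd _ (mem_bernstein_of_mem_Icc hρ hx)).continuousAt.comp
      continuous_ofReal.continuousAt).continuousWithinAt
  have hsum := hasSum_quadratureError hN ht0.le ht1 hint ha hs
  -- Only even indices from `2 * N` on contribute to the error.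
  have hinj : Function.Injective fun j : ℕ => 2 * (N + j) := fun i j hij => by
    simp only at hij; omega
  rw [← hinj.hasSum_iff] at hsum
  swap
  · intro n hn
    rcases Nat.even_or_odd n with he | ho
    · rw [quadratureError_T_of_lt]
      · simp
      by_contra hge
      obtain ⟨m, rfl⟩ := he
      exact hn ⟨m - N, by simp only; omega⟩
    · rw [quadratureError_T_of_odd N ho]; simp
  have hterm : ∀ j, ‖a (2 * (N + j))‖ ≤ 2 * K * (t ^ 2) ^ N * (t ^ 2) ^ j := fun j => by
    refine (ha _).trans_eq ?_
    rw [pow_mul, pow_add, mul_assoc (2 * K)]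
  have hfirst : ‖a (2 * (N + 0)) * (quadratureError N (Polynomial.Chebyshev.T ℝ (2 * (N + 0) : ℕ)) : ℂ)‖
      ≤ 2 * K * (t ^ 2) ^ N * (Real.pi / 2) := by
    have h1 := hterm 0
    rw [pow_zero, mul_one] at h1
    rw [norm_mul]
    refine mul_le_mul h1 ?_ (norm_nonneg _) (by positivity)
    rw [add_zero, quadratureError_T_two_mul hN, norm_real, Real.norm_eq_abs,
      abs_of_pos (Real.Wallis.W_pos N)]
    exact Real.Wallis.W_le N
  have hrest := (hasSum_nat_add_iff' 1).mpr hsum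
  rw [Finset.sum_range_one] at hrest
  have hgeo := (hasSum_geometric_of_lt_one (sq_nonneg t) ht2).mul_left
    (2 * K * (t ^ 2) ^ N * t ^ 2 * (32 / 15))
  have hbound := hrest.norm_le_of_bounded hgeo fun j => by
    simp only [Function.comp_apply, norm_mul, norm_real, Real.norm_eq_abs]
    calc _ ≤ 2 * K * (t ^ 2) ^ N * (t ^ 2) ^ (j + 1) * (32 / 15) := by
          gcongr
          · exact hterm (j + 1)
          · exact abs_quadratureError_T_le hN (by omega)
      _ = _ := by ring
  have htri := norm_le_norm_add_norm_sub'
    ((∫ x in (-1 : ℝ)..1, h x) - quadrature N h)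
    (a (2 * (N + 0)) * (quadratureError N (Polynomial.Chebyshev.T ℝ (2 * (N + 0) : ℕ)) : ℂ))
  refine htri.trans ((add_le_add hfirst hbound).trans_eq ?_)
  have e : t ^ 2 * (1 - t ^ 2)⁻¹ = 1 / (ρ ^ 2 - 1) := by
    rw [ht, inv_pow]
    have : (1 : ℝ) - (ρ ^ 2)⁻¹ = (ρ ^ 2 - 1) / ρ ^ 2 := by field_simp
    rw [this, inv_div]
    field_simp
  have e2 : (64 : ℝ) / (15 * (ρ ^ 2 - 1)) = 64 / 15 * (1 / (ρ ^ 2 - 1)) := by field_simp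
  rw [e2, ← e]
  ring

/-! ### Transfer to the segment and choice of `N`. -/

lemma rescale_mem_ellipse (z₁ z₂ : ℂ) {r : ℝ} {z : ℂ}
    (hz : ‖z - 1‖ + ‖z + 1‖ ≤ Real.exp r + (Real.exp r)⁻¹) :
    (1 / 2) * ((1 - z) * z₁ + (1 + z) * z₂) ∈ ellipse z₁ z₂ r := by
  have e1 : (1 / 2) * ((1 - z) * z₁ + (1 + z) * z₂) - z₁ = (z + 1) * ((z₂ - z₁) / 2) := by ring
  have e2 : (1 / 2) * ((1 - z) * z₁ + (1 + z) * z₂) - z₂ = (z - 1) * ((z₂ - z₁) / 2) := by ring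
  rw [ellipse, mem_ofPred_eq, e1, e2, norm_mul, norm_mul, norm_div, norm_ofNat, Real.cosh_eq,
    Real.exp_neg]
  have := mul_le_mul_of_nonneg_right hz (by positivity : 0 ≤ ‖z₂ - z₁‖ / 2)
  linarith

lemma segmentIntegral_eq (z₁ z₂ : ℂ) (g : ℂ → ℂ) :
    segmentIntegral z₁ z₂ g = ∫ x in (-1 : ℝ)..1, rescale z₁ z₂ g x := by
  rw [segmentIntegral, curveIntegral_segment]
  set f : ℝ → ℂ := fun s => g (AffineMap.lineMap z₁ z₂ s) * (z₂ - z₁) with hf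
  have h := intervalIntegral.integral_comp_mul_add (a := -1) (b := 1) f
    (by norm_num : (1 / 2 : ℝ) ≠ 0) (1 / 2)
  rw [show (1 / 2 : ℝ) * (-1) + 1 / 2 = 0 by norm_num,
    show (1 / 2 : ℝ) * 1 + 1 / 2 = 1 by norm_num] at h
  have h3 : (∫ t in (0 : ℝ)..1, f t) = (1 / 2 : ℝ) * ∫ x in (-1 : ℝ)..1, f (1 / 2 * x + 1 / 2) := by
    rw [h, real_smul]; push_cast; ring
  have h4 : ∀ x : ℝ, rescale z₁ z₂ g x = ((1 / 2 : ℝ) : ℂ) * f (1 / 2 * x + 1 / 2) := fun x => by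
    have : (1 / 2 : ℂ) * ((1 - x) * z₁ + (1 + x) * z₂)
        = AffineMap.lineMap z₁ z₂ (1 / 2 * x + 1 / 2 : ℝ) := by
      rw [AffineMap.lineMap_apply_module, real_smul, real_smul]
      push_cast; ring
    simp only [hf, rescale, this]
    push_cast; ring
  simp only [h4]
  rw [intervalIntegral.integral_const_mul, ← h3]
  simp [hf]

end GaussLegendre

theorem mainTheorem4 (g : ℂ → ℂ) (z₁ z₂ : ℂ) (r M Etol : ℝ) (N : ℕ)
    (hr : 0 < r) (hE : 0 < Etol)
    (hg : AnalyticOnNhd ℂ g (GaussLegendre.ellipse z₁ z₂ r))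
    (hM : ∀ z ∈ GaussLegendre.ellipse z₁ z₂ r, ‖g z‖ ≤ M)
    (hN : (N : ℝ) ≥ 1 / (2 * r) *
      (Real.log (Real.pi + 64 / (15 * (Real.exp (2 * r) - 1))) + Real.log M
        + Real.log (1 / 2 * ‖z₂ - z₁‖) - Real.log Etol)) :
    ‖GaussLegendre.segmentIntegral z₁ z₂ g
      - GaussLegendre.quadrature N (GaussLegendre.rescale z₁ z₂ g)‖ ≤ Etol := by
  have hρ : 1 < Real.exp r := Real.one_lt_exp_iff.mpr hr
  have hbound := GaussLegendre.norm_integral_sub_quadrature_le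
    (h := GaussLegendre.rescale z₁ z₂ g) (K := M * (1 / 2 * ‖z₂ - z₁‖)) N hρ
    (fun z hz => by
      have hgz := (hg _ (GaussLegendre.rescale_mem_ellipse z₁ z₂ hz)).differentiableAt
      have hin : DifferentiableAt ℂ (fun z : ℂ => (1 / 2) * ((1 - z) * z₁ + (1 + z) * z₂)) z := by
        fun_prop
      exact (hgz.comp z hin).const_mul _)
    (fun z hz => by
      have hgz := hM _ (GaussLegendre.rescale_mem_ellipse z₁ z₂ hz)
      rw [GaussLegendre.rescale, norm_mul, norm_div, Complex.norm_ofNat]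
      calc _ ≤ ‖z₂ - z₁‖ / 2 * M := by gcongr
        _ = _ := by ring)
  rw [← GaussLegendre.segmentIntegral_eq] at hbound
  refine hbound.trans ?_
  have hM0 : 0 ≤ M := (norm_nonneg _).trans (hM z₁ (by
    have := Real.one_le_cosh r
    simp only [GaussLegendre.ellipse, Set.mem_ofPred_eq, sub_self, norm_zero, zero_add]
    rw [norm_sub_rev]
    exact le_mul_of_one_le_left (norm_nonneg _) this))
  set A : ℝ := Real.pi + 64 / (15 * (Real.exp (2 * r) - 1)) with hA
  have hexp : Real.exp r ^ 2 = Real.exp (2 * r) := by rw [← Real.exp_nat_mul]; norm_num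
  rw [hexp, ← hA]
  have hA0 : 0 < A := by
    have : 0 < Real.exp (2 * r) - 1 := sub_pos.mpr (Real.one_lt_exp_iff.mpr (by linarith))
    have := Real.pi_pos
    positivity
  -- If `M = 0` or `z₁ = z₂`, the error bound itself is zero, so the convention `log 0 = 0` plays no
  -- role.
  rcases hM0.eq_or_lt with rfl | hMpos
  · simpa using hE.le
  rcases (norm_nonneg (z₂ - z₁)).eq_or_lt with hz | hz
  · rw [← hz]; simpa using hE.le
  have hzpos : 0 < 1 / 2 * ‖z₂ - z₁‖ := by positivity
  have hpow : ((Real.exp r)⁻¹ ^ 2) ^ N = Real.exp (-(2 * r * N)) := by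
    rw [← Real.exp_neg, ← pow_mul, ← Real.exp_nat_mul]
    congr 1; push_cast; ring
  have hlog : Real.log (M * (1 / 2 * ‖z₂ - z₁‖) * A)
      = Real.log A + Real.log M + Real.log (1 / 2 * ‖z₂ - z₁‖) := by
    rw [Real.log_mul (by positivity) hA0.ne', Real.log_mul hMpos.ne' hzpos.ne']
    ring
  have h2r : 0 < 2 * r := by linarith
  rw [ge_iff_le, one_div, inv_mul_le_iff₀ h2r, ← hlog] at hN
  rw [hpow, ← Real.exp_log (by positivity : 0 < M * (1 / 2 * ‖z₂ - z₁‖) * A), ← Real.exp_add,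
    ← Real.le_log_iff_exp_le hE]
  linarith
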